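/- For an integer $n\ge 0$, call a set $U\subseteq\mathbb R^2$ *$n$-universal* if every planar graph with $n$ vertices has a planar straight-line embedding with its vertices in $U$: the vertices are mapped to distinct points of $U$, each edge is drawn as the straight-line segment joining its endpoints, no vertex lies on an edge of which it is not an endpoint, and two different edges meet at most in a common endpoint. Let $m$ and $n$ be nonnegative integers with $m\le\left(\frac{n}{48e}\right)^2$, and let $Q$ be the set consisting of $m$ random points drawn independently and uniformly from the unit square $[0,1]^2$. Then, with probability at least $1-8\cdot 4^{-n/12}$, the set $Q$ is not $n$-universal. -/

import Mathlib

open MeasureTheory ProbabilityTheory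

/-- `IsPlaneDrawing G pos arc`: placing each vertex `v` at the point `pos v` and drawing each edge
`uv` as the point set `arc u v` is a drawing of `G` in the plane without crossings. -/
structure IsPlaneDrawing {V : Type*} (G : SimpleGraph V) (pos : V → ℝ × ℝ)
    (arc : V → V → Set (ℝ × ℝ)) : Prop where
  /-- Distinct vertices are placed at distinct points. -/
  pos_injective : Function.Injective pos
  /-- The drawing of an edge does not depend on its orientation. -/
  arc_symm : ∀ u v, G.Adj u v → arc u v = arc v u
  /-- Each edge is drawn as a simple arc that joins its two endpoints. -/
  isArc : ∀ u v, G.Adj u v →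
    ∃ γ : Path (pos u) (pos v), Function.Injective γ ∧ Set.range γ = arc u v
  /-- The only vertices on an edge are its endpoints. -/
  vertex_mem : ∀ u v w, G.Adj u v → pos w ∈ arc u v → w = u ∨ w = v
  /-- Two different edges meet at most in the endpoints that they share. -/
  inter_subset : ∀ u v x y, G.Adj u v → G.Adj x y → s(u, v) ≠ s(x, y) →
    arc u v ∩ arc x y ⊆ pos '' (({u, v} : Set V) ∩ {x, y})

/-- A graph is planar if it can be drawn in the plane without crossings, with edges drawn as
arbitrary simple arcs. -/
def IsPlanarGraph {V : Type*} (G : SimpleGraph V) : Prop :=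
  ∃ (pos : V → ℝ × ℝ) (arc : V → V → Set (ℝ × ℝ)), IsPlaneDrawing G pos arc

/-- `G` has a planar straight-line embedding that maps its vertices into the point set `U`. -/
def HasStraightLineEmbedding {V : Type*} (G : SimpleGraph V) (U : Set (ℝ × ℝ)) : Prop :=
  ∃ pos : V → ℝ × ℝ, (∀ v, pos v ∈ U) ∧
    IsPlaneDrawing G pos (fun u v => segment ℝ (pos u) (pos v))

/-- `U` is `n`-universal if every planar graph with `n` vertices has a planar straight-line
embedding that maps its vertices into `U`. -/
def IsUniversalPointSet (n : ℕ) (U : Set (ℝ × ℝ)) : Prop :=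
  ∀ G : SimpleGraph (Fin n), IsPlanarGraph G → HasStraightLineEmbedding G U

/-- The unit square. -/
def unitSquare : Set (ℝ × ℝ) := Set.Icc (0 : ℝ) 1 ×ˢ Set.Icc (0 : ℝ) 1

/-! The cube of the path on `n` vertices is planar, and every straight-line drawing of it has about
`n / 12` vertices that, listed by increasing x, have monotone y. Random points rarely contain so
long a chain.

Cut the path into `n / 3` triples of consecutive vertices, each spanning a triangle. The vertices
just before and just after a triple are adjacent to all of it, and two such vertices cannot both lie
outside its triangle (`mem_triangleInterior_or`). So each triangle except the first and last
contains the previous or the next one. The triangles therefore grow up to some index and shrink from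
there on (`exists_nested_split`), and at least half of them are nested in one another. Each triangle
has a vertex at a corner of its bounding box (`exists_corner`); for at least half of the nested
triangles these corners lie on the same diagonal direction, and such corners form the chain
(`exists_monotone_chain`). Planarity is shown by repeatedly inserting centroids
(`isPlanarGraph_pathCube`).

For `k` given random points in a given order, x is increasing with probability at most `1 / k!` and,
independently, y is monotone with probability at most `2 / k!`. A union bound over at most `m ^ k`
ordered choices (`measureReal_exists_monotone_le`) and `k! ≥ (k / e) ^ k` finish the proof. -/

/-! ### Triangles, barycentric coordinates and crossings -/

/-- Twice the signed area of the triangle `abc`. -/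
def signedArea (a b c : ℝ × ℝ) : ℝ :=
  (b.1 - a.1) * (c.2 - a.2) - (b.2 - a.2) * (c.1 - a.1)

/-- The points with positive barycentric coordinates with respect to `a`, `b`, `c`. -/
def triangleInterior (a b c : ℝ × ℝ) : Set (ℝ × ℝ) :=
  {z | ∃ α β γ : ℝ, 0 < α ∧ 0 < β ∧ 0 < γ ∧ α + β + γ = 1 ∧ z = α • a + β • b + γ • c}

lemma exists_barycentric {a b c : ℝ × ℝ} (h : signedArea a b c ≠ 0) (z : ℝ × ℝ) :
    ∃ α β γ : ℝ, α + β + γ = 1 ∧ z = α • a + β • b + γ • c := by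
  refine ⟨signedArea z b c / signedArea a b c, signedArea a z c / signedArea a b c,
    signedArea a b z / signedArea a b c, ?_, ?_⟩
  · field_simp
    simp only [signedArea]
    ring
  · ext
    · simp only [Prod.fst_add, Prod.smul_fst, smul_eq_mul]
      field_simp
      simp only [signedArea]
      ring
    · simp only [Prod.snd_add, Prod.smul_snd, smul_eq_mul]
      field_simp
      simp only [signedArea]
      ring

/-- Dividing `heq` by the common total weight gives a point of both segments. The next lemmas
exhibit their crossings through such identities. -/
lemma not_disjoint_segment {a b c d : ℝ × ℝ} {s t s' t' : ℝ} (hs : 0 ≤ s) (ht : 0 ≤ t)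
    (hs' : 0 ≤ s') (ht' : 0 ≤ t') (hpos : 0 < s + t) (hsum : s + t = s' + t')
    (heq : s • a + t • b = s' • c + t' • d) :
    ¬ Disjoint (segment ℝ a b) (segment ℝ c d) := by
  intro h
  have h1 : (s + t)⁻¹ • (s • a + t • b) ∈ segment ℝ a b := by
    refine ⟨s / (s + t), t / (s + t), by positivity, by positivity, by field_simp, ?_⟩
    rw [smul_add, smul_smul, smul_smul, div_eq_inv_mul, div_eq_inv_mul]
  have h2 : (s + t)⁻¹ • (s • a + t • b) ∈ segment ℝ c d := by
    rw [heq, hsum]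
    rw [hsum] at hpos
    refine ⟨s' / (s' + t'), t' / (s' + t'), by positivity, by positivity, by field_simp, ?_⟩
    rw [smul_add, smul_smul, smul_smul, div_eq_inv_mul, div_eq_inv_mul]
  exact Set.disjoint_left.mp h h1 h2

/-- If only the coordinate at `a` were nonpositive, moving its term to the left would show that `pa`
meets `bc`. What remains is the interior and, for each vertex, the cone opposite to the triangle at
that vertex. -/
lemma barycentric_signs {a b c p : ℝ × ℝ} {α β γ : ℝ} (hsum : α + β + γ = 1)
    (hp : p = α • a + β • b + γ • c)
    (ha : Disjoint (segment ℝ p a) (segment ℝ b c))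
    (hb : Disjoint (segment ℝ p b) (segment ℝ c a))
    (hc : Disjoint (segment ℝ p c) (segment ℝ a b)) :
    (0 < α ∧ 0 < β ∧ 0 < γ) ∨ (β < 0 ∧ γ < 0) ∨ (γ < 0 ∧ α < 0) ∨ (α < 0 ∧ β < 0) := by
  have h1 : ¬ (α ≤ 0 ∧ 0 ≤ β ∧ 0 ≤ γ) := by
    rintro ⟨h1, h2, h3⟩
    refine not_disjoint_segment (s := 1) (t := -α) zero_le_one (by linarith) h2 h3 (by linarith)
      (by linarith) ?_ ha
    rw [hp]; module
  have h2 : ¬ (β ≤ 0 ∧ 0 ≤ γ ∧ 0 ≤ α) := by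
    rintro ⟨h1, h2, h3⟩
    refine not_disjoint_segment (s := 1) (t := -β) zero_le_one (by linarith) h2 h3 (by linarith)
      (by linarith) ?_ hb
    rw [hp]; module
  have h3 : ¬ (γ ≤ 0 ∧ 0 ≤ α ∧ 0 ≤ β) := by
    rintro ⟨h1, h2, h3⟩
    refine not_disjoint_segment (s := 1) (t := -γ) zero_le_one (by linarith) h2 h3 (by linarith)
      (by linarith) ?_ hc
    rw [hp]; module
  rcases lt_or_ge α 0 with h4 | h4 <;> rcases lt_or_ge β 0 with h5 | h5 <;>
    rcases lt_or_ge γ 0 with h6 | h6 <;> simp_all [not_le] <;> linarith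

/-- Each of the four crossings is decided by the signs of two 2×2 minors of the coordinates of `p`
and `q`. Excluding all four contradicts the linear relation that the three minors satisfy with
coefficients `α`, `β`, `γ`. -/
lemma false_of_same_cone {a b c p q : ℝ × ℝ} {α β γ α' β' γ' : ℝ} (hsum : α + β + γ = 1)
    (hsum' : α' + β' + γ' = 1) (hp : p = α • a + β • b + γ • c)
    (hq : q = α' • a + β' • b + γ' • c) (hβ : β < 0) (hγ : γ < 0) (hβ' : β' < 0) (hγ' : γ' < 0)
    (h1 : Disjoint (segment ℝ p a) (segment ℝ q b))
    (h2 : Disjoint (segment ℝ p a) (segment ℝ q c))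
    (h3 : Disjoint (segment ℝ p b) (segment ℝ q a))
    (h4 : Disjoint (segment ℝ p c) (segment ℝ q a)) : False := by
  have k1 : ¬ (0 ≤ γ * β' - γ' * β ∧ 0 ≤ γ' * α - γ * α') := by
    rintro ⟨k, k'⟩
    refine not_disjoint_segment (s := -γ') (t := γ' * α - γ * α') (s' := -γ)
      (t' := γ * β' - γ' * β) (by linarith) k' (by linarith) k (by linarith) ?_ ?_ h1
    · linear_combination γ' * hsum - γ * hsum'
    · rw [hp, hq]; module
  have k2 : ¬ (0 ≤ β * γ' - β' * γ ∧ 0 ≤ β' * α - β * α') := by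
    rintro ⟨k, k'⟩
    refine not_disjoint_segment (s := -β') (t := β' * α - β * α') (s' := -β)
      (t' := β * γ' - β' * γ) (by linarith) k' (by linarith) k (by linarith) ?_ ?_ h2
    · linear_combination β' * hsum - β * hsum'
    · rw [hp, hq]; module
  have k3 : ¬ (0 ≤ γ' * β - γ * β' ∧ 0 ≤ γ * α' - γ' * α) := by
    rintro ⟨k, k'⟩
    refine not_disjoint_segment (s := -γ') (t := γ' * β - γ * β') (s' := -γ)
      (t' := γ * α' - γ' * α) (by linarith) k (by linarith) k' (by linarith) ?_ ?_ h3
    · linear_combination γ' * hsum - γ * hsum'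
    · rw [hp, hq]; module
  have k4 : ¬ (0 ≤ β' * γ - β * γ' ∧ 0 ≤ β * α' - β' * α) := by
    rintro ⟨k, k'⟩
    refine not_disjoint_segment (s := -β') (t := β' * γ - β * γ') (s' := -β)
      (t' := β * α' - β' * α) (by linarith) k (by linarith) k' (by linarith) ?_ ?_ h4
    · linear_combination β' * hsum - β * hsum'
    · rw [hp, hq]; module
  have hα : 0 < α := by linarith
  have hα' : 0 < α' := by linarith
  rcases le_total (γ' * β) (γ * β') with h | h
  · have e : γ' * α < γ * α' := by
      by_contra e
      exact k1 ⟨by linarith, by linarith⟩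
    have f : β * α' < β' * α := by
      by_contra f
      exact k4 ⟨by linarith, by linarith⟩
    nlinarith [mul_pos_of_neg_of_neg hβ hγ, mul_le_mul_of_nonneg_left h hα.le,
      mul_lt_mul_of_neg_left e hβ, mul_lt_mul_of_neg_left f hγ]
  · have e : γ * α' < γ' * α := by
      by_contra e
      exact k3 ⟨by linarith, by linarith⟩
    have f : β' * α < β * α' := by
      by_contra f
      exact k2 ⟨by linarith, by linarith⟩
    nlinarith [mul_pos_of_neg_of_neg hβ hγ, mul_le_mul_of_nonneg_left h hα.le,
      mul_lt_mul_of_neg_left e hβ, mul_lt_mul_of_neg_left f hγ]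

/-- With `p` behind `a` and `q` behind `b`, the segments `pb` and `qa` always cross: eliminating `c`
gives the common point. -/
lemma false_of_different_cones {a b c p q : ℝ × ℝ} {α β γ α' β' γ' : ℝ} (hsum : α + β + γ = 1)
    (hsum' : α' + β' + γ' = 1) (hp : p = α • a + β • b + γ • c)
    (hq : q = α' • a + β' • b + γ' • c) (hβ : β < 0) (hγ : γ < 0) (hα' : α' < 0) (hγ' : γ' < 0)
    (h : Disjoint (segment ℝ p b) (segment ℝ q a)) : False := by
  have hα : 0 < α := by linarith
  have hβ' : 0 < β' := by linarith
  have e1 := mul_pos_of_neg_of_neg hγ hα'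
  have e2 := mul_pos_of_neg_of_neg hγ' hβ
  have e3 := mul_pos hα (neg_pos.mpr hγ')
  have e4 := mul_pos hβ' (neg_pos.mpr hγ)
  refine not_disjoint_segment (s := -γ') (t := γ' * β - γ * β') (s' := -γ)
      (t' := γ * α' - γ' * α) (by linarith) (by linarith) (by linarith) (by linarith)
      (by linarith) ?_ ?_ h
  · linear_combination γ' * hsum - γ * hsum'
  · rw [hp, hq]; module

/-- Two points that see all three vertices of a triangle without crossings cannot both lie
outside it. -/
lemma mem_triangleInterior_or {a b c p q : ℝ × ℝ} (h : signedArea a b c ≠ 0)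
    (hpa : Disjoint (segment ℝ p a) (segment ℝ b c))
    (hpb : Disjoint (segment ℝ p b) (segment ℝ c a))
    (hpc : Disjoint (segment ℝ p c) (segment ℝ a b))
    (hqa : Disjoint (segment ℝ q a) (segment ℝ b c))
    (hqb : Disjoint (segment ℝ q b) (segment ℝ c a))
    (hqc : Disjoint (segment ℝ q c) (segment ℝ a b))
    (hab : Disjoint (segment ℝ p a) (segment ℝ q b))
    (hac : Disjoint (segment ℝ p a) (segment ℝ q c))
    (hba : Disjoint (segment ℝ p b) (segment ℝ q a))
    (hbc : Disjoint (segment ℝ p b) (segment ℝ q c))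
    (hca : Disjoint (segment ℝ p c) (segment ℝ q a))
    (hcb : Disjoint (segment ℝ p c) (segment ℝ q b)) :
    p ∈ triangleInterior a b c ∨ q ∈ triangleInterior a b c := by
  obtain ⟨α, β, γ, hs, hp⟩ := exists_barycentric h p
  obtain ⟨α', β', γ', hs', hq⟩ := exists_barycentric h q
  have hp1 : p = β • b + γ • c + α • a := by rw [hp]; module
  have hq1 : q = β' • b + γ' • c + α' • a := by rw [hq]; module
  have hp2 : p = γ • c + α • a + β • b := by rw [hp]; module
  have hq2 : q = γ' • c + α' • a + β' • b := by rw [hq]; module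
  have hs1 : β + γ + α = 1 := by linarith
  have hs1' : β' + γ' + α' = 1 := by linarith
  have hs2 : γ + α + β = 1 := by linarith
  have hs2' : γ' + α' + β' = 1 := by linarith
  rcases barycentric_signs hs hp hpa hpb hpc with h1 | ⟨h1, h2⟩ | ⟨h1, h2⟩ | ⟨h1, h2⟩
  · exact Or.inl ⟨α, β, γ, h1.1, h1.2.1, h1.2.2, hs, hp⟩
  -- The nine remaining pairs of cones reduce to the two lemmas by rotating `a`, `b`, `c` and
  -- exchanging `p` and `q`.
  all_goals
    rcases barycentric_signs hs' hq hqa hqb hqc with h3 | ⟨h3, h4⟩ | ⟨h3, h4⟩ | ⟨h3, h4⟩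
    · exact Or.inr ⟨α', β', γ', h3.1, h3.2.1, h3.2.2, hs', hq⟩
  · exact (false_of_same_cone hs hs' hp hq h1 h2 h3 h4 hab hac hba hca).elim
  · exact (false_of_different_cones hs hs' hp hq h1 h2 h4 h3 hba).elim
  · exact (false_of_different_cones hs2' hs2 hq2 hp2 h3 h4 h2 h1 hca.symm).elim
  · exact (false_of_different_cones hs' hs hq hp h3 h4 h2 h1 hab.symm).elim
  · exact (false_of_same_cone hs1 hs1' hp1 hq1 h1 h2 h3 h4 hbc hba hcb hab).elim
  · exact (false_of_different_cones hs1 hs1' hp1 hq1 h1 h2 h4 h3 hcb).elim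
  · exact (false_of_different_cones hs2 hs2' hp2 hq2 h1 h2 h4 h3 hac).elim
  · exact (false_of_different_cones hs1' hs1 hq1 hp1 h3 h4 h2 h1 hbc.symm).elim
  · exact (false_of_same_cone hs2 hs2' hp2 hq2 h1 h2 h3 h4 hca hcb hac hbc).elim

/-- Along `pq` the least barycentric coordinate varies continuously. If `q` were not interior, it
would vanish somewhere, and there the segment meets a side. -/
lemma mem_triangleInterior_of_disjoint {a b c p q : ℝ × ℝ} (h : signedArea a b c ≠ 0)
    (hp : p ∈ triangleInterior a b c) (hab : Disjoint (segment ℝ p q) (segment ℝ a b))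
    (hbc : Disjoint (segment ℝ p q) (segment ℝ b c))
    (hca : Disjoint (segment ℝ p q) (segment ℝ c a)) : q ∈ triangleInterior a b c := by
  obtain ⟨α, β, γ, hα, hβ, hγ, hs, hp⟩ := hp
  obtain ⟨α', β', γ', hs', hq⟩ := exists_barycentric h q
  by_contra hcon
  have hneg : min α' (min β' γ') ≤ 0 := by
    by_contra hpos
    simp only [not_le, lt_min_iff] at hpos
    exact hcon ⟨α', β', γ', hpos.1, hpos.2.1, hpos.2.2, hs', hq⟩
  let f : ℝ → ℝ := fun t => min ((1 - t) * α + t * α')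
    (min ((1 - t) * β + t * β') ((1 - t) * γ + t * γ'))
  have hf : Continuous f := by fun_prop
  have h0 : 0 ≤ f 0 := by simp [f, hα.le, hβ.le, hγ.le]
  have h1 : f 1 ≤ 0 := by simpa [f] using hneg
  obtain ⟨t, ⟨ht0, ht1⟩, ht⟩ := intermediate_value_Icc' zero_le_one hf.continuousOn ⟨h1, h0⟩
  have hz : (1 - t) • p + t • q ∈ segment ℝ p q :=
    ⟨1 - t, t, by linarith, ht0, by ring, rfl⟩
  set x := (1 - t) * α + t * α' with hx
  set y := (1 - t) * β + t * β' with hy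
  set z := (1 - t) * γ + t * γ' with hz'
  have hxyz : x + y + z = 1 := by
    rw [hx, hy, hz']
    linear_combination (1 - t) * hs + t * hs'
  have hcomb : (1 - t) • p + t • q = x • a + y • b + z • c := by
    rw [hp, hq, hx, hy, hz']; module
  have hmin : min x (min y z) = 0 := ht
  have hx0 : 0 ≤ x := hmin ▸ min_le_left _ _
  have hy0 : 0 ≤ y := hmin ▸ (min_le_right _ _).trans (min_le_left _ _)
  have hz0 : 0 ≤ z := hmin ▸ (min_le_right _ _).trans (min_le_right _ _)
  have hor : x = 0 ∨ y = 0 ∨ z = 0 := by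
    rcases min_choice x (min y z) with e | e
    · exact Or.inl (e ▸ hmin)
    · rcases min_choice y z with e' | e'
      · exact Or.inr (Or.inl (by rw [← e', ← e, hmin]))
      · exact Or.inr (Or.inr (by rw [← e', ← e, hmin]))
  rcases hor with e | e | e
  · refine Set.disjoint_left.mp hbc hz ⟨y, z, hy0, hz0, by linarith, ?_⟩
    rw [hcomb, e]; module
  · refine Set.disjoint_left.mp hca hz ⟨z, x, hz0, hx0, by linarith, ?_⟩
    rw [hcomb, e]; module
  · refine Set.disjoint_left.mp hab hz ⟨x, y, hx0, hy0, by linarith, ?_⟩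
    rw [hcomb, e]; module

lemma triangleInterior_trans {a b c a' b' c' z : ℝ × ℝ} (ha : a' ∈ triangleInterior a b c)
    (hb : b' ∈ triangleInterior a b c) (hc : c' ∈ triangleInterior a b c)
    (hz : z ∈ triangleInterior a' b' c') : z ∈ triangleInterior a b c := by
  obtain ⟨α, β, γ, hα, hβ, hγ, hs, hz⟩ := hz
  obtain ⟨x1, y1, z1, hx1, hy1, hz1, hs1, ha⟩ := ha
  obtain ⟨x2, y2, z2, hx2, hy2, hz2, hs2, hb⟩ := hb
  obtain ⟨x3, y3, z3, hx3, hy3, hz3, hs3, hc⟩ := hc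
  refine ⟨α * x1 + β * x2 + γ * x3, α * y1 + β * y2 + γ * y3, α * z1 + β * z2 + γ * z3,
    by positivity, by positivity, by positivity, ?_, ?_⟩
  · linear_combination α * hs1 + β * hs2 + γ * hs3 + hs
  · rw [hz, ha, hb, hc]; module

lemma vertex_notMem_triangleInterior {a b c : ℝ × ℝ} (h : signedArea a b c ≠ 0) :
    a ∉ triangleInterior a b c := by
  rintro ⟨α, β, γ, hα, hβ, hγ, hs, ha⟩
  have h1 : a.1 = α * a.1 + β * b.1 + γ * c.1 := by simpa using congrArg Prod.fst ha
  have h2 : a.2 = α * a.2 + β * b.2 + γ * c.2 := by simpa using congrArg Prod.snd ha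
  apply h
  have hα' : α = 1 - β - γ := by linarith
  subst hα'
  have : β * signedArea a b c = 0 := by
    simp only [signedArea]
    linear_combination (-(c.2 - a.2)) * h1 + (c.1 - a.1) * h2
  exact (mul_eq_zero.mp this).resolve_left hβ.ne'

/-- Some vertex of a triangle is a corner of its bounding box. -/
lemma exists_corner {T : Fin 3 → ℝ × ℝ} (h : signedArea (T 0) (T 1) (T 2) ≠ 0) :
    ∃ i, (∀ z ∈ triangleInterior (T 0) (T 1) (T 2),
        0 < ((T i).1 - z.1) * ((T i).2 - z.2)) ∨
      ∀ z ∈ triangleInterior (T 0) (T 1) (T 2),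
        ((T i).1 - z.1) * ((T i).2 - z.2) < 0 := by
  have key : ∀ f : Fin 3 → ℝ, (∃ i j, f i ≠ f j) → ∃ i j, i ≠ j ∧
      (∀ α β γ : ℝ, 0 < α → 0 < β → 0 < γ → α + β + γ = 1 →
        f i < α * f 0 + β * f 1 + γ * f 2 ∧ α * f 0 + β * f 1 + γ * f 2 < f j) := by
    intro f ⟨i', j', hij⟩
    obtain ⟨i, hi⟩ := Finite.exists_min f
    obtain ⟨j, hj⟩ := Finite.exists_max f
    have hlt : f i < f j := by
      rcases hij.lt_or_gt with h | h
      · exact (hi i').trans_lt (h.trans_le (hj j'))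
      · exact (hi j').trans_lt (h.trans_le (hj i'))
    refine ⟨i, j, fun e => hlt.ne (congrArg f e), fun α β γ hα hβ hγ hs => ?_⟩
    have a0 := hi 0
    have a1 := hi 1
    have a2 := hi 2
    have b0 := hj 0
    have b1 := hj 1
    have b2 := hj 2
    have hα' : α = 1 - β - γ := by linarith
    subst hα'
    have c1 : 0 < (1 - β - γ) * (f 0 - f i) + β * (f 1 - f i) + γ * (f 2 - f i) := by
      have e0 := mul_nonneg hα.le (sub_nonneg.mpr a0)
      have e1 := mul_nonneg hβ.le (sub_nonneg.mpr a1)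
      have e2 := mul_nonneg hγ.le (sub_nonneg.mpr a2)
      have hj' : j = 0 ∨ j = 1 ∨ j = 2 := by omega
      rcases hj' with e | e | e <;> subst e
      · linarith [mul_pos hα (sub_pos.mpr hlt)]
      · linarith [mul_pos hβ (sub_pos.mpr hlt)]
      · linarith [mul_pos hγ (sub_pos.mpr hlt)]
    have c2 : 0 < (1 - β - γ) * (f j - f 0) + β * (f j - f 1) + γ * (f j - f 2) := by
      have e0 := mul_nonneg hα.le (sub_nonneg.mpr b0)
      have e1 := mul_nonneg hβ.le (sub_nonneg.mpr b1)
      have e2 := mul_nonneg hγ.le (sub_nonneg.mpr b2)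
      have hi' : i = 0 ∨ i = 1 ∨ i = 2 := by omega
      rcases hi' with e | e | e <;> subst e
      · linarith [mul_pos hα (sub_pos.mpr hlt)]
      · linarith [mul_pos hβ (sub_pos.mpr hlt)]
      · linarith [mul_pos hγ (sub_pos.mpr hlt)]
    constructor <;> linarith
  obtain ⟨i, j, hij, hx⟩ := key (fun i => (T i).1) (by
    by_contra! hc
    have h1 := hc 0 1
    have h2 := hc 0 2
    apply h
    simp only [signedArea, ← h1, ← h2]
    ring)
  obtain ⟨k, l, hkl, hy⟩ := key (fun i => (T i).2) (by
    by_contra! hc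
    have h1 := hc 0 1
    have h2 := hc 0 2
    apply h
    simp only [signedArea, ← h1, ← h2]
    ring)
  have hz : ∀ z ∈ triangleInterior (T 0) (T 1) (T 2),
      (T i).1 < z.1 ∧ z.1 < (T j).1 ∧ (T k).2 < z.2 ∧ z.2 < (T l).2 := by
    rintro z ⟨α, β, γ, hα, hβ, hγ, hs, rfl⟩
    have e1 := hx α β γ hα hβ hγ hs
    have e2 := hy α β γ hα hβ hγ hs
    simp only [Prod.fst_add, Prod.smul_fst, smul_eq_mul, Prod.snd_add, Prod.smul_snd]
    exact ⟨e1.1, e1.2, e2.1, e2.2⟩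
  -- Two pairs of distinct indices out of three must share one: a vertex extreme in both
  -- coordinates.
  have hor : i = k ∨ i = l ∨ j = k ∨ j = l := by omega
  rcases hor with e | e | e | e <;> subst e
  · exact ⟨i, Or.inl fun z h => mul_pos_of_neg_of_neg (by linarith [(hz z h).1])
      (by linarith [(hz z h).2.2.1])⟩
  · exact ⟨i, Or.inr fun z h => mul_neg_of_neg_of_pos (by linarith [(hz z h).1])
      (by linarith [(hz z h).2.2.2])⟩
  · exact ⟨j, Or.inr fun z h => mul_neg_of_pos_of_neg (by linarith [(hz z h).2.1])
      (by linarith [(hz z h).2.2.1])⟩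
  · exact ⟨j, Or.inl fun z h => mul_pos (by linarith [(hz z h).2.1])
      (by linarith [(hz z h).2.2.2])⟩

/-! ### Nested triangles and monotone chains -/

/-- Read `R i j` as "triangle `i` contains triangle `j`". Once `i` contains `i + 1`, the latter
cannot contain `i`, so it contains `i + 2`: after the first descent the nesting only descends. -/
lemma exists_nested_split {R : ℕ → ℕ → Prop} (htrans : ∀ i j k, R i j → R j k → R i k)
    (hirr : ∀ i, ¬ R i i) (t : ℕ)
    (h : ∀ i, i + 2 < t → R (i + 1) (i + 2) ∨ R (i + 1) i) :
    ∃ j ≤ t, (∀ a b, a < b → b < j → R b a) ∧ ∀ a b, j ≤ a → a < b → b < t → R a b := by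
  induction t with
  | zero => exact ⟨0, le_rfl, by omega, by omega⟩
  | succ t ih =>
    obtain ⟨j, hj, h1, h2⟩ := ih fun i hi => h i (by omega)
    rcases Nat.lt_or_ge t 2 with ht | ht
    · refine ⟨t, by omega, fun a b _ _ => by omega, fun a b _ _ _ => by omega⟩
    obtain ⟨s, rfl⟩ := Nat.exists_eq_add_of_le' ht
    rcases h s (by omega) with h3 | h3
    · refine ⟨j, by omega, h1, fun a b ha hab hb => ?_⟩
      rcases Nat.lt_or_ge b (s + 2) with hb' | hb'
      · exact h2 a b ha hab hb'
      · obtain rfl : b = s + 2 := by omega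
        rcases Nat.lt_or_ge a (s + 1) with ha' | ha'
        · exact htrans _ _ _ (h2 a (s + 1) ha ha' (by omega)) h3
        · obtain rfl : a = s + 1 := by omega
          exact h3
    -- An ascent at the end rules out any earlier descent, so the whole sequence up to `s + 1`
    -- ascends and the tail is the single index `s + 2`.
    · have hj' : s + 1 ≤ j := by
        by_contra hc
        exact hirr _ (htrans _ _ _ h3 (h2 s (s + 1) (by omega) (by omega) (by omega)))
      refine ⟨s + 2, by omega, fun a b hab hb => ?_, fun a b _ _ _ => by omega⟩
      rcases Nat.lt_or_ge b j with hb' | hb'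
      · exact h1 a b hab hb'
      · obtain rfl : b = s + 1 := by omega
        rcases Nat.lt_or_ge a s with ha' | ha'
        · exact htrans _ _ _ h3 (h1 a s ha' (by omega))
        · obtain rfl : a = s := by omega
          exact h3

/-- In a straight-line drawing of the cube of a path, many vertices form a strictly increasing or
a strictly decreasing chain. -/
lemma exists_monotone_chain (n : ℕ) (v : ℕ → ℝ × ℝ)
    (harea : ∀ i, i + 2 < n → signedArea (v i) (v (i + 1)) (v (i + 2)) ≠ 0)
    (hdisj : ∀ i j k l, i < n → j < n → k < n → l < n → i ≠ j → k ≠ l → i ≠ k → i ≠ l → j ≠ k →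
      j ≠ l → i ≤ j + 3 → j ≤ i + 3 → k ≤ l + 3 → l ≤ k + 3 →
      Disjoint (segment ℝ (v i) (v j)) (segment ℝ (v k) (v l))) :
    ∃ S : Finset ℕ, (∀ i ∈ S, i < n) ∧ n ≤ 12 * S.card + 2 ∧
      ((∀ i ∈ S, ∀ j ∈ S, i ≠ j → 0 < ((v i).1 - (v j).1) * ((v i).2 - (v j).2)) ∨
        ∀ i ∈ S, ∀ j ∈ S, i ≠ j → ((v i).1 - (v j).1) * ((v i).2 - (v j).2) < 0) := by
  classical
  let t := n / 3
  have ht : 3 * t ≤ n := Nat.mul_div_le n 3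
  let I : ℕ → Set (ℝ × ℝ) := fun i => triangleInterior (v (3 * i)) (v (3 * i + 1)) (v (3 * i + 2))
  -- The clause `i < t` keeps the triangle among the drawn, nondegenerate ones, as irreflexivity
  -- requires.
  let R : ℕ → ℕ → Prop := fun i j => i < t ∧ v (3 * j) ∈ I i ∧ v (3 * j + 1) ∈ I i ∧
    v (3 * j + 2) ∈ I i
  have htrans : ∀ i j k, R i j → R j k → R i k := by
    rintro i j k ⟨h0, h1, h2, h3⟩ ⟨-, h4, h5, h6⟩
    exact ⟨h0, triangleInterior_trans h1 h2 h3 h4, triangleInterior_trans h1 h2 h3 h5,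
      triangleInterior_trans h1 h2 h3 h6⟩
  have hirr : ∀ i, ¬ R i i := fun i ⟨h0, h1, _⟩ =>
    vertex_notMem_triangleInterior (harea (3 * i) (by omega)) h1
  have hstep : ∀ i, i + 2 < t → R (i + 1) (i + 2) ∨ R (i + 1) i := by
    intro i hi
    have hA := harea (3 * (i + 1)) (by omega)
    have D : ∀ x y z w : ℕ, x < n ∧ y < n ∧ z < n ∧ w < n ∧ x ≠ y ∧ z ≠ w ∧ x ≠ z ∧ x ≠ w ∧
        y ≠ z ∧ y ≠ w ∧ x ≤ y + 3 ∧ y ≤ x + 3 ∧ z ≤ w + 3 ∧ w ≤ z + 3 →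
        Disjoint (segment ℝ (v x) (v y)) (segment ℝ (v z) (v w)) := by
      rintro x y z w ⟨h1, h2, h3, h4, h5, h6, h7, h8, h9, h10, h11, h12, h13, h14⟩
      exact hdisj x y z w h1 h2 h3 h4 h5 h6 h7 h8 h9 h10 h11 h12 h13 h14
    -- An edge with both ends off the triple cannot cross the triangle, so one interior vertex pulls
    -- in the rest of its own triple.
    have G : ∀ x y, v x ∈ I (i + 1) → x < n ∧ y < n ∧ x ≠ y ∧ x ≤ y + 3 ∧ y ≤ x + 3 ∧
        (y < 3 * (i + 1) ∨ 3 * (i + 1) + 2 < y) ∧ (x < 3 * (i + 1) ∨ 3 * (i + 1) + 2 < x) →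
        v y ∈ I (i + 1) := by
      intro x y hx hxy
      exact mem_triangleInterior_of_disjoint hA hx (D _ _ _ _ (by omega)) (D _ _ _ _ (by omega))
        (D _ _ _ _ (by omega))
    have h := mem_triangleInterior_or (p := v (3 * i + 2)) (q := v (3 * (i + 2))) hA
      (D _ _ _ _ (by omega)) (D _ _ _ _ (by omega)) (D _ _ _ _ (by omega))
      (D _ _ _ _ (by omega)) (D _ _ _ _ (by omega)) (D _ _ _ _ (by omega))
      (D _ _ _ _ (by omega)) (D _ _ _ _ (by omega)) (D _ _ _ _ (by omega))
      (D _ _ _ _ (by omega)) (D _ _ _ _ (by omega)) (D _ _ _ _ (by omega))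
    rcases h with h | h
    · exact Or.inr ⟨by omega, G _ _ h (by omega), G _ _ h (by omega), h⟩
    · exact Or.inl ⟨by omega, h, G _ _ h (by omega), G _ _ h (by omega)⟩
  obtain ⟨j, hj, h1, h2⟩ := exists_nested_split htrans hirr t hstep
  obtain ⟨A, hAt, hAcard, hA⟩ : ∃ A : Finset ℕ, (∀ i ∈ A, i < t) ∧ t ≤ 2 * A.card ∧
      ∀ a ∈ A, ∀ b ∈ A, a ≠ b → R a b ∨ R b a := by
    rcases Nat.lt_or_ge (2 * j) t with hjt | hjt
    · refine ⟨Finset.Ico j t, by simp, by simp; omega, fun a ha b hb hab => ?_⟩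
      rw [Finset.mem_Ico] at ha hb
      rcases Nat.lt_or_gt_of_ne hab with h | h
      · exact Or.inl (h2 a b ha.1 h hb.2)
      · exact Or.inr (h2 b a hb.1 h ha.2)
    · refine ⟨Finset.range j, fun i hi => by simp at hi; omega, by simpa using hjt,
        fun a ha b hb hab => ?_⟩
      rw [Finset.mem_range] at ha hb
      rcases Nat.lt_or_gt_of_ne hab with h | h
      · exact Or.inr (h1 a b h hb)
      · exact Or.inl (h1 b a h ha)
  have hcorner : ∀ i, ∃ w, i < t → 3 * i ≤ w ∧ w ≤ 3 * i + 2 ∧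
      ((∀ z ∈ I i, 0 < ((v w).1 - z.1) * ((v w).2 - z.2)) ∨
        ∀ z ∈ I i, ((v w).1 - z.1) * ((v w).2 - z.2) < 0) := by
    intro i
    by_cases hi : i < t
    · obtain ⟨k, hk⟩ := exists_corner (T := fun k : Fin 3 => v (3 * i + k))
        (harea (3 * i) (by omega))
      exact ⟨3 * i + k, fun _ => ⟨by omega, by omega, hk⟩⟩
    · exact ⟨0, fun h => absurd h hi⟩
  choose w hw using hcorner
  have hmem : ∀ a b, b < t → R a b → v (w b) ∈ I a := by
    rintro a b hb ⟨-, h3, h4, h5⟩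
    obtain ⟨e1, e2, -⟩ := hw b hb
    have : w b = 3 * b ∨ w b = 3 * b + 1 ∨ w b = 3 * b + 2 := by omega
    rcases this with e | e | e <;> rw [e] <;> assumption
  have hinj : Set.InjOn w A := by
    intro a ha b hb hab
    have e1 := hw a (hAt a ha)
    have e2 := hw b (hAt b hb)
    omega
  -- `p` separates the two diagonal directions; the more frequent one keeps at least half of `A`.
  let p : ℕ → Prop := fun i => ∀ z ∈ I i, 0 < ((v (w i)).1 - z.1) * ((v (w i)).2 - z.2)
  have hsplit := Finset.card_filter_add_card_filter_not (s := A) p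
  rcases Nat.lt_or_ge (2 * (A.filter p).card) A.card with hlt | hge
  · refine ⟨(A.filter fun i => ¬ p i).image w, ?_, ?_, Or.inr ?_⟩
    · intro i hi
      obtain ⟨a, ha, rfl⟩ := Finset.mem_image.mp hi
      have := hw a (hAt a (Finset.mem_filter.mp ha).1)
      have := hAt a (Finset.mem_filter.mp ha).1
      omega
    · rw [Finset.card_image_of_injOn (hinj.mono (Finset.coe_subset.mpr (Finset.filter_subset _ _)))]
      omega
    · intro i hi k hk hik
      obtain ⟨a, ha, rfl⟩ := Finset.mem_image.mp hi
      obtain ⟨b, hb, rfl⟩ := Finset.mem_image.mp hk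
      obtain ⟨ha, hpa⟩ := Finset.mem_filter.mp ha
      obtain ⟨hb, hpb⟩ := Finset.mem_filter.mp hb
      rcases hA a ha b hb (fun e => hik (congrArg w e)) with h | h
      · exact ((hw a (hAt a ha)).2.2.resolve_left hpa) _ (hmem a b (hAt b hb) h)
      · have := ((hw b (hAt b hb)).2.2.resolve_left hpb) _ (hmem b a (hAt a ha) h)
        linarith
  · refine ⟨(A.filter p).image w, ?_, ?_, Or.inl ?_⟩
    · intro i hi
      obtain ⟨a, ha, rfl⟩ := Finset.mem_image.mp hi
      have := hw a (hAt a (Finset.mem_filter.mp ha).1)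
      have := hAt a (Finset.mem_filter.mp ha).1
      omega
    · rw [Finset.card_image_of_injOn (hinj.mono (Finset.coe_subset.mpr (Finset.filter_subset _ _)))]
      omega
    · intro i hi k hk hik
      obtain ⟨a, ha, rfl⟩ := Finset.mem_image.mp hi
      obtain ⟨b, hb, rfl⟩ := Finset.mem_image.mp hk
      obtain ⟨ha, hpa⟩ := Finset.mem_filter.mp ha
      obtain ⟨hb, hpb⟩ := Finset.mem_filter.mp hb
      rcases hA a ha b hb (fun e => hik (congrArg w e)) with h | h
      · exact hpa _ (hmem a b (hAt b hb) h)
      · have := hpb _ (hmem b a (hAt a ha) h)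
        linarith

/-! ### A planar drawing of the cube of a path -/

lemma barycentric_unique {a b c : ℝ × ℝ} (h : signedArea a b c ≠ 0) {α β γ α' β' γ' : ℝ}
    (hs : α + β + γ = α' + β' + γ')
    (heq : α • a + β • b + γ • c = α' • a + β' • b + γ' • c) : α = α' ∧ β = β' ∧ γ = γ' := by
  have h1 : α * a.1 + β * b.1 + γ * c.1 = α' * a.1 + β' * b.1 + γ' * c.1 := by
    simpa using congrArg Prod.fst heq
  have h2 : α * a.2 + β * b.2 + γ * c.2 = α' * a.2 + β' * b.2 + γ' * c.2 := by
    simpa using congrArg Prod.snd heq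
  have e1 : (α - α') * signedArea a b c = 0 := by
    simp only [signedArea]
    linear_combination (b.2 - c.2) * h1 + (c.1 - b.1) * h2 + (b.1 * c.2 - c.1 * b.2) * hs
  have e2 : (β - β') * signedArea a b c = 0 := by
    simp only [signedArea]
    linear_combination (c.2 - a.2) * h1 + (a.1 - c.1) * h2 + (c.1 * a.2 - a.1 * c.2) * hs
  have e3 := (mul_eq_zero.mp e1).resolve_right h
  have e4 := (mul_eq_zero.mp e2).resolve_right h
  exact ⟨by linarith, by linarith, by linarith⟩

/-- Each point of the sequence is the centroid of the three preceding ones. -/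
noncomputable def centroidSeq : ℕ → ℝ × ℝ
  | 0 => (0, 0)
  | 1 => (1, 0)
  | 2 => (0, 1)
  | k + 3 => (1 / 3 : ℝ) • (centroidSeq k + centroidSeq (k + 1) + centroidSeq (k + 2))

/-- The interior of the triangle of three consecutive points of `centroidSeq`. -/
def centroidTriangle (k : ℕ) : Set (ℝ × ℝ) :=
  triangleInterior (centroidSeq k) (centroidSeq (k + 1)) (centroidSeq (k + 2))

lemma centroidSeq_add_three (k : ℕ) : centroidSeq (k + 3) =
    (1 / 3 : ℝ) • (centroidSeq k + centroidSeq (k + 1) + centroidSeq (k + 2)) := by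
  rw [centroidSeq]

lemma signedArea_centroidSeq (k : ℕ) :
    signedArea (centroidSeq k) (centroidSeq (k + 1)) (centroidSeq (k + 2)) ≠ 0 := by
  induction k with
  | zero => simp [signedArea, centroidSeq]
  | succ k ih =>
    have : signedArea (centroidSeq (k + 1)) (centroidSeq (k + 2)) (centroidSeq (k + 3)) =
        1 / 3 * signedArea (centroidSeq k) (centroidSeq (k + 1)) (centroidSeq (k + 2)) := by
      rw [centroidSeq_add_three]
      simp only [signedArea, Prod.smul_fst, Prod.smul_snd, Prod.fst_add, Prod.snd_add,
        smul_eq_mul]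
      ring
    rw [show k + 1 + 1 = k + 2 from rfl, show k + 1 + 2 = k + 3 from rfl, this]
    exact mul_ne_zero (by norm_num) ih

lemma centroidTriangle_antitone : Antitone centroidTriangle := by
  refine antitone_nat_of_succ_le fun k => ?_
  rintro z ⟨α, β, γ, hα, hβ, hγ, hs, rfl⟩
  refine ⟨γ / 3, α + γ / 3, β + γ / 3, by positivity, by positivity, by positivity,
    by linarith, ?_⟩
  rw [show k + 1 + 1 = k + 2 from rfl, show k + 1 + 2 = k + 3 from rfl, centroidSeq_add_three]
  module

/-- The segment runs from a corner of the triangle to its centroid, so all of it but the corner is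
interior. -/
lemma mem_centroidTriangle_of_mem_segment {i j : ℕ} {z : ℝ × ℝ} (hij : i < j) (hji : j ≤ i + 3)
    (hj : 3 ≤ j) (hz : z ∈ segment ℝ (centroidSeq i) (centroidSeq j)) (hne : z ≠ centroidSeq i) :
    z ∈ centroidTriangle (j - 3) := by
  obtain ⟨k, rfl⟩ := Nat.exists_eq_add_of_le' hj
  rw [Nat.add_sub_cancel]
  obtain ⟨s, t, hs, ht, hst, rfl⟩ := hz
  have ht' : 0 < t := by
    refine ht.lt_of_ne fun e => hne ?_
    rw [← e, show s = 1 by linarith]; module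
  rw [centroidSeq_add_three]
  have : i = k ∨ i = k + 1 ∨ i = k + 2 := by omega
  rcases this with e | e | e <;> subst e
  · exact ⟨s + t / 3, t / 3, t / 3, by positivity, by positivity, by positivity, by linarith,
      by module⟩
  · exact ⟨t / 3, s + t / 3, t / 3, by positivity, by positivity, by positivity, by linarith,
      by module⟩
  · exact ⟨t / 3, t / 3, s + t / 3, by positivity, by positivity, by positivity, by linarith,
      by module⟩

/-- By nesting it suffices to treat `l = j + 1`. In coordinates of triangle `j - 3`, the interior of
the next triangle is where the first coordinate is strictly the smallest, which fails all along the
segment. -/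
lemma notMem_centroidTriangle_of_mem_segment {i j l : ℕ} {z : ℝ × ℝ} (hij : i < j)
    (hji : j ≤ i + 3) (hj : 3 ≤ j) (hjl : j < l)
    (hz : z ∈ segment ℝ (centroidSeq i) (centroidSeq j)) : z ∉ centroidTriangle (l - 3) := by
  obtain ⟨k, rfl⟩ := Nat.exists_eq_add_of_le' hj
  intro h
  obtain ⟨α, β, γ, hα, hβ, hγ, hsum, he⟩ := centroidTriangle_antitone (by omega : k + 1 ≤ l - 3) h
  obtain ⟨s, t, hs, ht, hst, rfl⟩ := hz
  rw [show k + 1 + 1 = k + 2 from rfl, show k + 1 + 2 = k + 3 from rfl,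
    centroidSeq_add_three] at he
  have : i = k ∨ i = k + 1 ∨ i = k + 2 := by omega
  rcases this with e | e | e <;> subst e
  · have := barycentric_unique (signedArea_centroidSeq i) (α := s + t / 3) (β := t / 3)
      (γ := t / 3) (α' := γ / 3) (β' := α + γ / 3) (γ' := β + γ / 3) (by linarith)
      (by convert he using 1 <;> module)
    linarith
  · have := barycentric_unique (signedArea_centroidSeq k) (α := t / 3) (β := s + t / 3)
      (γ := t / 3) (α' := γ / 3) (β' := α + γ / 3) (γ' := β + γ / 3) (by linarith)
      (by convert he using 1 <;> module)
    linarith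
  · have := barycentric_unique (signedArea_centroidSeq k) (α := t / 3) (β := t / 3)
      (γ := s + t / 3) (α' := γ / 3) (β' := α + γ / 3) (γ' := β + γ / 3) (by linarith)
      (by convert he using 1 <;> module)
    linarith

lemma centroidSeq_mem_centroidTriangle {j : ℕ} (hj : 3 ≤ j) :
    centroidSeq j ∈ centroidTriangle (j - 3) := by
  obtain ⟨k, rfl⟩ := Nat.exists_eq_add_of_le' hj
  rw [Nat.add_sub_cancel, centroidSeq_add_three]
  exact ⟨1 / 3, 1 / 3, 1 / 3, by norm_num, by norm_num, by norm_num, by norm_num, by module⟩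

lemma centroidSeq_notMem_centroidTriangle {j l : ℕ} (hj : 3 ≤ j) (hl : j < l) :
    centroidSeq j ∉ centroidTriangle (l - 3) :=
  notMem_centroidTriangle_of_mem_segment (i := j - 1) (by omega) (by omega) hj hl
    (right_mem_segment _ _ _)

lemma centroidSeq_ne {i j : ℕ} (hi : 3 ≤ i) (hij : i < j) : centroidSeq i ≠ centroidSeq j :=
  fun e => centroidSeq_notMem_centroidTriangle hi hij
    (e ▸ centroidSeq_mem_centroidTriangle (by omega))

lemma eq_of_centroidSeq_mem_segment {i j w : ℕ} (hi : 3 ≤ i) (hij : i < j) (hji : j ≤ i + 3)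
    (hw : 3 ≤ w) (h : centroidSeq w ∈ segment ℝ (centroidSeq i) (centroidSeq j)) :
    w = i ∨ w = j := by
  by_contra! hne
  rcases Nat.lt_or_gt_of_ne hne.2 with h1 | h1
  · refine centroidSeq_notMem_centroidTriangle hw h1
      (mem_centroidTriangle_of_mem_segment hij hji (by omega) h ?_)
    rcases Nat.lt_or_gt_of_ne hne.1 with h2 | h2
    · exact centroidSeq_ne hw h2
    · exact (centroidSeq_ne hi h2).symm
  · exact notMem_centroidTriangle_of_mem_segment hij hji (by omega) h1 h
      (centroidSeq_mem_centroidTriangle hw)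

lemma eq_of_mem_segment_of_mem_segment {i k j : ℕ} {z : ℝ × ℝ} (hik : i ≠ k) (hij : i < j)
    (hji : j ≤ i + 3) (hkj : k < j) (hjk : j ≤ k + 3) (hj : 3 ≤ j)
    (h1 : z ∈ segment ℝ (centroidSeq i) (centroidSeq j))
    (h2 : z ∈ segment ℝ (centroidSeq k) (centroidSeq j)) : z = centroidSeq j := by
  obtain ⟨m, rfl⟩ := Nat.exists_eq_add_of_le' hj
  obtain ⟨s, t, hs, ht, hst, rfl⟩ := h1
  obtain ⟨s', t', hs', ht', hst', he⟩ := h2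
  suffices s = 0 by
    rw [this, show t = 1 by linarith]; module
  rw [centroidSeq_add_three] at he
  have hu := fun {α β γ α' β' γ' : ℝ} =>
    barycentric_unique (signedArea_centroidSeq m) (α := α) (β := β) (γ := γ) (α' := α')
      (β' := β') (γ' := γ')
  have hi : i = m ∨ i = m + 1 ∨ i = m + 2 := by omega
  have hk : k = m ∨ k = m + 1 ∨ k = m + 2 := by omega
  have key : ∀ f g : Fin 3 → ℝ,
      f 0 + f 1 + f 2 = s' → g 0 + g 1 + g 2 = s →
      ((f 0 + t' / 3) • centroidSeq m + (f 1 + t' / 3) • centroidSeq (m + 1) +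
        (f 2 + t' / 3) • centroidSeq (m + 2) : ℝ × ℝ) =
      (g 0 + t / 3) • centroidSeq m + (g 1 + t / 3) • centroidSeq (m + 1) +
        (g 2 + t / 3) • centroidSeq (m + 2) → ∀ i, f i + t' / 3 = g i + t / 3 := by
    intro f g hf hg hfg
    have := hu (by linarith) hfg
    intro i
    fin_cases i
    · exact this.1
    · exact this.2.1
    · exact this.2.2
  rcases hi with e | e | e <;> rcases hk with e' | e' | e' <;> subst e <;> subst e'
  · exact absurd rfl hik
  · have := key ![0, s', 0] ![s, 0, 0] (by simp) (by simp) (by simp; convert he using 1 <;> module)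
    have a0 := this 0
    have a1 := this 1
    simp at a0 a1
    linarith
  · have := key ![0, 0, s'] ![s, 0, 0] (by simp) (by simp) (by simp; convert he using 1 <;> module)
    have a0 := this 0
    have a1 := this 2
    simp at a0 a1
    linarith
  · have := key ![s', 0, 0] ![0, s, 0] (by simp) (by simp) (by simp; convert he using 1 <;> module)
    have a0 := this 0
    have a1 := this 1
    simp at a0 a1
    linarith
  · exact absurd rfl hik
  · have := key ![0, 0, s'] ![0, s, 0] (by simp) (by simp) (by simp; convert he using 1 <;> module)
    have a0 := this 1
    have a1 := this 2
    simp at a0 a1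
    linarith
  · have := key ![s', 0, 0] ![0, 0, s] (by simp) (by simp) (by simp; convert he using 1 <;> module)
    have a0 := this 0
    have a1 := this 2
    simp at a0 a1
    linarith
  · have := key ![0, s', 0] ![0, 0, s] (by simp) (by simp) (by simp; convert he using 1 <;> module)
    have a0 := this 1
    have a1 := this 2
    simp at a0 a1
    linarith
  · exact absurd rfl hik

/-- If the later ends satisfy `j < l`, the second segment minus its end `k` lies inside a triangle
whose interior the first avoids. If `j = l`, both run from different corners to the same centroid.
-/
lemma exists_common_endpoint {i j k l : ℕ} {z : ℝ × ℝ} (hi : 3 ≤ i) (hij : i < j)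
    (hji : j ≤ i + 3) (hk : 3 ≤ k) (hkl : k < l) (hlk : l ≤ k + 3) (hne : i ≠ k ∨ j ≠ l)
    (h1 : z ∈ segment ℝ (centroidSeq i) (centroidSeq j))
    (h2 : z ∈ segment ℝ (centroidSeq k) (centroidSeq l)) :
    ∃ w, (w = i ∨ w = j) ∧ (w = k ∨ w = l) ∧ centroidSeq w = z := by
  wlog hjl : j ≤ l generalizing i j k l
  · obtain ⟨w, hw1, hw2, hw⟩ := this hk hkl hlk hi hij hji (by omega) h2 h1 (by omega)
    exact ⟨w, hw2, hw1, hw⟩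
  rcases hjl.lt_or_eq with hlt | rfl
  · have hz : z = centroidSeq k := by
      by_contra hz
      exact notMem_centroidTriangle_of_mem_segment hij hji (by omega) hlt h1
        (mem_centroidTriangle_of_mem_segment hkl hlk (by omega) h2 hz)
    subst hz
    exact ⟨k, eq_of_centroidSeq_mem_segment hi hij hji hk h1, Or.inl rfl, rfl⟩
  · exact ⟨j, Or.inr rfl, Or.inr rfl, (eq_of_mem_segment_of_mem_segment (by omega) hij hji hkl hlk
      (by omega) h1 h2).symm⟩

lemma exists_path_range_eq_segment {a b : ℝ × ℝ} (h : a ≠ b) :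
    ∃ γ : Path a b, Function.Injective γ ∧ Set.range γ = segment ℝ a b := by
  refine ⟨⟨⟨fun t => AffineMap.lineMap a b (t : ℝ), by
    simp only [AffineMap.lineMap_apply_module]; fun_prop⟩, by simp, by simp⟩,
    fun s t hst => ?_, ?_⟩
  · exact Subtype.ext (AffineMap.lineMap_injective ℝ h hst)
  · rw [segment_eq_image_lineMap]
    ext z
    constructor
    · rintro ⟨t, rfl⟩
      exact ⟨t, t.2, rfl⟩
    · rintro ⟨t, ht, rfl⟩
      exact ⟨⟨t, ht⟩, rfl⟩

/-- The cube of the path on `n` vertices. -/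
def pathCube (n : ℕ) : SimpleGraph (Fin n) where
  Adj i j := i ≠ j ∧ (i : ℕ) ≤ j + 3 ∧ (j : ℕ) ≤ i + 3
  symm := ⟨fun _ _ h => ⟨h.1.symm, h.2.2, h.2.1⟩⟩
  loopless := ⟨fun _ h => h.1 rfl⟩

lemma isPlanarGraph_pathCube (n : ℕ) : IsPlanarGraph (pathCube n) := by
  -- The shift by 3 makes every vertex the centroid of a triangle.
  let pos : Fin n → ℝ × ℝ := fun i => centroidSeq (i + 3)
  have hinj : Function.Injective pos := by
    intro i j hij
    rcases lt_trichotomy i j with h | h | h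
    · exact absurd hij (centroidSeq_ne (by omega) (by omega))
    · exact h
    · exact absurd hij.symm (centroidSeq_ne (by omega) (by omega))
  have sorted : ∀ u v, (pathCube n).Adj u v → ∃ u' v' : Fin n,
      u' < v' ∧ (v' : ℕ) ≤ u' + 3 ∧ segment ℝ (pos u) (pos v) = segment ℝ (pos u') (pos v') ∧
      ((u' = u ∧ v' = v) ∨ (u' = v ∧ v' = u)) := by
    rintro u v ⟨h1, h2, h3⟩
    rcases lt_or_gt_of_ne h1 with h | h
    · exact ⟨u, v, h, h3, rfl, Or.inl ⟨rfl, rfl⟩⟩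
    · exact ⟨v, u, h, h2, segment_symm _ _ _, Or.inr ⟨rfl, rfl⟩⟩
  refine ⟨pos, fun u v => segment ℝ (pos u) (pos v), hinj, fun u v _ => segment_symm _ _ _,
    fun u v h => exists_path_range_eq_segment (hinj.ne h.1), ?_, ?_⟩
  · intro u v w h hw
    obtain ⟨u', v', h1, h2, h3, h4⟩ := sorted u v h
    beta_reduce at hw
    rw [h3] at hw
    have := eq_of_centroidSeq_mem_segment (by omega) (by omega) (by omega) (by omega) hw
    have : w = u' ∨ w = v' := by omega
    rcases h4 with ⟨rfl, rfl⟩ | ⟨rfl, rfl⟩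
    · exact this
    · exact this.symm
  · rintro u v x y h h' hne z ⟨hz1, hz2⟩
    obtain ⟨u', v', h1, h2, h3, h4⟩ := sorted u v h
    obtain ⟨x', y', h1', h2', h3', h4'⟩ := sorted x y h'
    rw [h3] at hz1
    rw [h3'] at hz2
    have hne' : u' ≠ x' ∨ v' ≠ y' := by
      by_contra! hc
      apply hne
      rw [Sym2.eq_iff]
      omega
    obtain ⟨w, hw1, hw2, rfl⟩ := exists_common_endpoint (by omega) (by omega) (by omega) (by omega)
      (by omega) (by omega) (by omega) hz1 hz2
    have key : ∀ w' : Fin n, (w' : ℕ) + 3 = w →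
        centroidSeq w ∈ pos '' (({u, v} : Set (Fin n)) ∩ {x, y}) := by
      rintro w' rfl
      refine ⟨w', ⟨?_, ?_⟩, rfl⟩
      · simp only [Set.mem_insert_iff, Set.mem_singleton_iff]
        omega
      · simp only [Set.mem_insert_iff, Set.mem_singleton_iff]
        omega
    rcases hw1 with e | e
    · exact key u' e.symm
    · exact key v' e.symm

/-! ### Chains in drawings and their probability -/

/-- A straight-line drawing of the cube of a path contains a long strictly monotone chain. -/
lemma exists_monotone_chain_of_isPlaneDrawing {n : ℕ} {pos : Fin n → ℝ × ℝ}
    (h : IsPlaneDrawing (pathCube n) pos fun u v => segment ℝ (pos u) (pos v)) :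
    ∃ S : Finset (Fin n), n ≤ 12 * S.card + 2 ∧
      ((∀ i ∈ S, ∀ j ∈ S, i ≠ j →
          0 < ((pos i).1 - (pos j).1) * ((pos i).2 - (pos j).2)) ∨
        ∀ i ∈ S, ∀ j ∈ S, i ≠ j →
          ((pos i).1 - (pos j).1) * ((pos i).2 - (pos j).2) < 0) := by
  classical
  let v : ℕ → ℝ × ℝ := fun i => if hi : i < n then pos ⟨i, hi⟩ else 0
  have hv : ∀ i (hi : i < n), v i = pos ⟨i, hi⟩ := fun i hi => dif_pos hi
  -- Three consecutive vertices are pairwise adjacent; if collinear, one would lie on the edge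
  -- joining the other two.
  have harea : ∀ i, i + 2 < n → signedArea (v i) (v (i + 1)) (v (i + 2)) ≠ 0 := by
    intro i hi hA
    have hcol : Collinear ℝ {v i, v (i + 1), v (i + 2)} := by
      have hne : v (i + 1) - v i ≠ 0 := by
        rw [sub_ne_zero, hv i (by omega), hv (i + 1) (by omega)]
        exact h.pos_injective.ne (by simp)
      rw [collinear_iff_of_mem (p₀ := v i) (by simp)]
      refine ⟨v (i + 1) - v i, ?_⟩
      have : ∃ r : ℝ, v (i + 2) = r • (v (i + 1) - v i) + v i := by
        have hA' : ((v (i + 1)).1 - (v i).1) * ((v (i + 2)).2 - (v i).2) =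
            ((v (i + 1)).2 - (v i).2) * ((v (i + 2)).1 - (v i).1) := by
          simp only [signedArea] at hA
          linarith
        by_cases h0 : (v (i + 1)).1 - (v i).1 = 0
        · have h1 : (v (i + 1)).2 - (v i).2 ≠ 0 := fun h1 => hne (Prod.ext h0 h1)
          refine ⟨((v (i + 2)).2 - (v i).2) / ((v (i + 1)).2 - (v i).2), Prod.ext ?_ ?_⟩
          · simp only [Prod.fst_add, Prod.smul_fst, Prod.fst_sub, smul_eq_mul, h0]
            rw [h0, zero_mul, eq_comm] at hA'
            have := (mul_eq_zero.mp hA').resolve_left h1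
            linarith
          · simp only [Prod.snd_add, Prod.smul_snd, Prod.snd_sub, smul_eq_mul]
            field_simp
            ring
        · refine ⟨((v (i + 2)).1 - (v i).1) / ((v (i + 1)).1 - (v i).1), Prod.ext ?_ ?_⟩
          · simp only [Prod.fst_add, Prod.smul_fst, Prod.fst_sub, smul_eq_mul]
            field_simp
            ring
          · simp only [Prod.snd_add, Prod.smul_snd, Prod.snd_sub, smul_eq_mul]
            field_simp
            linarith
      intro p hp
      simp only [Set.mem_insert_iff, Set.mem_singleton_iff] at hp
      rcases hp with rfl | rfl | rfl
      · exact ⟨0, by simp⟩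
      · exact ⟨1, by simp⟩
      · simpa using this
    have hno : ∀ x y z : ℕ, x < n ∧ y < n ∧ z < n ∧ x ≠ y ∧ x ≤ y + 3 ∧ y ≤ x + 3 ∧ z ≠ x ∧
        z ≠ y → ¬ Wbtw ℝ (v x) (v z) (v y) := by
      rintro x y z ⟨hx, hy, hz, h1, h2, h3, h4, h5⟩ hw
      rw [← mem_segment_iff_wbtw, hv x hx, hv y hy, hv z hz] at hw
      have := h.vertex_mem ⟨x, hx⟩ ⟨y, hy⟩ ⟨z, hz⟩ ⟨by simpa using h1, h2, h3⟩ hw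
      simp at this
      omega
    rcases hcol.wbtw_or_wbtw_or_wbtw with hw | hw | hw
    · exact hno _ _ _ (by omega) hw
    · exact hno _ _ _ (by omega) hw
    · exact hno _ _ _ (by omega) hw
  have hdisj : ∀ i j k l, i < n → j < n → k < n → l < n → i ≠ j → k ≠ l → i ≠ k → i ≠ l → j ≠ k →
      j ≠ l → i ≤ j + 3 → j ≤ i + 3 → k ≤ l + 3 → l ≤ k + 3 →
      Disjoint (segment ℝ (v i) (v j)) (segment ℝ (v k) (v l)) := by
    intro i j k l hi hj hk hl h1 h2 h3 h4 h5 h6 h7 h8 h9 h10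
    rw [hv i hi, hv j hj, hv k hk, hv l hl, Set.disjoint_iff]
    intro z hz
    obtain ⟨w, ⟨hw1, hw2⟩, -⟩ := h.inter_subset ⟨i, hi⟩ ⟨j, hj⟩ ⟨k, hk⟩ ⟨l, hl⟩
      ⟨by simpa using h1, h7, h8⟩ ⟨by simpa using h2, h9, h10⟩ (by simp [h3, h4]) hz
    simp only [Set.mem_insert_iff, Set.mem_singleton_iff, Fin.ext_iff] at hw1 hw2
    omega
  obtain ⟨S, hS, hcard, hor⟩ := exists_monotone_chain n v harea hdisj
  let S' : Finset (Fin n) := Finset.univ.filter fun i => (i : ℕ) ∈ S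
  have hS' : S'.card = S.card := by
    refine Finset.card_bij (fun i _ => (i : ℕ)) (fun i hi => (Finset.mem_filter.mp hi).2)
      (fun i _ j _ hij => Fin.ext hij) fun b hb => ⟨⟨b, hS b hb⟩, ?_, rfl⟩
    simpa [S'] using hb
  refine ⟨S', by omega, ?_⟩
  have hpos : ∀ i : Fin n, pos i = v i := fun i => (hv i i.2).symm
  simp only [hpos]
  rcases hor with hor | hor
  · exact Or.inl fun i hi j hj hij => hor i (Finset.mem_filter.mp hi).2 j
      (Finset.mem_filter.mp hj).2 (by omega)
  · exact Or.inr fun i hi j hj hij => hor i (Finset.mem_filter.mp hi).2 j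
      (Finset.mem_filter.mp hj).2 (by omega)

lemma measurableSet_strictMono_comp {ι κ : Type*} [Countable κ] [Preorder κ] (f : κ → ι) :
    MeasurableSet {x : ι → ℝ | StrictMono (x ∘ f)} := by
  have : {x : ι → ℝ | StrictMono (x ∘ f)} =
      ⋂ (i : κ) (j : κ) (_ : i < j), {x | x (f i) < x (f j)} := by
    ext x
    simp [StrictMono]
  rw [this]
  exact MeasurableSet.iInter fun i => MeasurableSet.iInter fun j => MeasurableSet.iInter fun _ =>
    measurableSet_lt (measurable_pi_apply _) (measurable_pi_apply _)

lemma pi_strictMono_comp_perm (μ : Measure ℝ) [IsProbabilityMeasure μ] {k : ℕ}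
    (σ : Equiv.Perm (Fin k)) :
    Measure.pi (fun _ : Fin k => μ) {x | StrictMono (x ∘ σ)} =
      Measure.pi (fun _ : Fin k => μ) {x | StrictMono x} := by
  have h := measurePreserving_piCongrLeft (α := fun _ : Fin k => ℝ) (μ := fun _ => μ) σ
  rw [← h.measure_preimage (measurableSet_strictMono_comp σ).nullMeasurableSet]
  congr 1
  ext x
  simp only [Set.preimage_ofPred_eq, Set.mem_ofPred_eq]
  have : (MeasurableEquiv.piCongrLeft (fun _ : Fin k => ℝ) σ) x ∘ σ = x := by
    ext i
    exact MeasurableEquiv.piCongrLeft_apply_apply (β := fun _ : Fin k => ℝ) σ x i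
  rw [this]

/-- The `k!` orderings are disjoint events of equal probability. Ties only lower that probability,
so atoms of `μ` do no harm. -/
lemma pi_strictMono_le (μ : Measure ℝ) [IsProbabilityMeasure μ] (k : ℕ) :
    Measure.pi (fun _ : Fin k => μ) {x | StrictMono x} ≤ (k.factorial : ENNReal)⁻¹ := by
  have hdisj : Pairwise (Function.onFun Disjoint
      fun σ : Equiv.Perm (Fin k) => {x : Fin k → ℝ | StrictMono (x ∘ σ)}) := by
    intro σ τ hne
    refine Set.disjoint_left.mpr fun x (h1 : StrictMono (x ∘ σ)) (h2 : StrictMono (x ∘ τ)) => hne ?_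
    have h3 : x ∘ σ = x ∘ τ := by
      refine (h1.range_inj h2).mp ?_
      rw [σ.surjective.range_comp, τ.surjective.range_comp]
    have hx : Function.Injective x := by
      have := h1.injective
      exact (Function.Injective.of_comp_iff' x σ.bijective).mp this
    exact Equiv.ext fun i => hx (congrFun h3 i)
  have h := tsum_measure_le_measure_univ (μ := Measure.pi (fun _ : Fin k => μ))
    (s := fun σ : Equiv.Perm (Fin k) => {x : Fin k → ℝ | StrictMono (x ∘ σ)})
    (fun σ => (measurableSet_strictMono_comp σ).nullMeasurableSet)
    (fun _ _ hne => (hdisj hne).aedisjoint)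
  rw [measure_univ, tsum_fintype] at h
  simp only [pi_strictMono_comp_perm, Finset.sum_const, Finset.card_univ, Fintype.card_perm,
    Fintype.card_fin, nsmul_eq_mul] at h
  rw [ENNReal.le_inv_iff_mul_le, mul_comm]
  exact h

lemma volume_unitSquare : volume unitSquare = 1 := by
  rw [unitSquare, Measure.volume_eq_prod, Measure.prod_prod]
  simp

lemma cond_unitSquare : ProbabilityTheory.cond volume unitSquare =
    (volume.restrict (Set.Icc (0 : ℝ) 1)).prod (volume.restrict (Set.Icc (0 : ℝ) 1)) := by
  rw [ProbabilityTheory.cond, volume_unitSquare, inv_one, one_smul, Measure.prod_restrict,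
    ← Measure.volume_eq_prod, unitSquare]

section

variable {Ω : Type*} [MeasurableSpace Ω] {P : Measure Ω} [IsProbabilityMeasure P] {m : ℕ}
  {X : Fin m → Ω → ℝ × ℝ}

lemma measure_monotone_le (hindep : iIndepFun X P)
    (hunif : ∀ i, pdf.IsUniform (X i) unitSquare P volume) {k : ℕ} (e : Fin k ↪ Fin m) :
    P {ω | (StrictMono fun j => (X (e j) ω).1) ∧
      ((StrictMono fun j => (X (e j) ω).2) ∨ StrictAnti fun j => (X (e j) ω).2)} ≤
      2 * (k.factorial : ENNReal)⁻¹ ^ 2 := by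
  have hmeas : ∀ i, AEMeasurable (X i) P := fun i =>
    (hunif i).aemeasurable (by simp [volume_unitSquare]) (by simp [volume_unitSquare])
  let μ : Measure ℝ := volume.restrict (Set.Icc (0 : ℝ) 1)
  have hμ : IsProbabilityMeasure μ := ⟨by simp [μ]⟩
  have hlaw : P.map (fun ω j => X (e j) ω) = Measure.pi fun _ => μ.prod μ := by
    rw [(iIndepFun_iff_map_fun_eq_pi_map fun j => hmeas (e j)).mp (hindep.precomp e.injective)]
    congr 1
    ext1 j
    exact (hunif (e j)).trans cond_unitSquare
  have hprod := measurePreserving_arrowProdEquivProdArrow ℝ ℝ (Fin k) (fun _ => μ) (fun _ => μ)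
  have hrev : {x : Fin k → ℝ | StrictMono (x ∘ Fin.revPerm)} = {x | StrictAnti x} := by
    ext x
    constructor
    · intro h i j hij
      have := h (Fin.rev_lt_rev.mpr hij)
      simpa using this
    · intro h i j hij
      exact h (Fin.rev_lt_rev.mpr hij)
  let M : Set (Fin k → ℝ) := {x | StrictMono x}
  let N : Set (Fin k → ℝ) := {x | StrictAnti x}
  have hM : MeasurableSet M := measurableSet_strictMono_comp id
  have hN : MeasurableSet N := by
    have := measurableSet_strictMono_comp (Fin.revPerm (n := k))
    rwa [hrev] at this
  have hset : {ω | (StrictMono fun j => (X (e j) ω).1) ∧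
      ((StrictMono fun j => (X (e j) ω).2) ∨ StrictAnti fun j => (X (e j) ω).2)} =
      (fun ω j => X (e j) ω) ⁻¹'
        (MeasurableEquiv.arrowProdEquivProdArrow ℝ ℝ (Fin k) ⁻¹' (M ×ˢ (M ∪ N))) := rfl
  have hMN : MeasurableSet (M ×ˢ (M ∪ N)) := hM.prod (hM.union hN)
  rw [hset, ← Measure.map_apply_of_aemeasurable (aemeasurable_pi_lambda _ fun j => hmeas (e j))
    (hprod.measurable hMN), hlaw, hprod.measure_preimage hMN.nullMeasurableSet, Measure.prod_prod]
  have hM' : Measure.pi (fun _ : Fin k => μ) M ≤ (k.factorial : ENNReal)⁻¹ := pi_strictMono_le μ k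
  have hN' : Measure.pi (fun _ : Fin k => μ) N ≤ (k.factorial : ENNReal)⁻¹ := by
    have := pi_strictMono_comp_perm μ (Fin.revPerm (n := k))
    rw [hrev] at this
    exact this.trans_le hM'
  calc _ ≤ (k.factorial : ENNReal)⁻¹ * ((k.factorial : ENNReal)⁻¹ + (k.factorial : ENNReal)⁻¹) :=
        mul_le_mul' hM' ((measure_union_le _ _).trans (add_le_add hM' hN'))
    _ = _ := by ring

lemma measureReal_exists_monotone_le (hindep : iIndepFun X P)
    (hunif : ∀ i, pdf.IsUniform (X i) unitSquare P volume) (k : ℕ) :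
    P.real {ω | ∃ e : Fin k ↪ Fin m, (StrictMono fun j => (X (e j) ω).1) ∧
      ((StrictMono fun j => (X (e j) ω).2) ∨ StrictAnti fun j => (X (e j) ω).2)} ≤
      2 * (m : ℝ) ^ k / (k.factorial : ℝ) ^ 2 := by
  rw [Set.ofPred_exists]
  refine (measureReal_iUnion_fintype_le _).trans ?_
  have h : ∀ e : Fin k ↪ Fin m, P.real {ω | (StrictMono fun j => (X (e j) ω).1) ∧
      ((StrictMono fun j => (X (e j) ω).2) ∨ StrictAnti fun j => (X (e j) ω).2)} ≤
      2 * ((k.factorial : ℝ)⁻¹) ^ 2 := by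
    intro e
    have := ENNReal.toReal_mono (by
      simp [ENNReal.mul_eq_top, Nat.factorial_ne_zero]) (measure_monotone_le hindep hunif e)
    simpa [Measure.real] using this
  refine (Finset.sum_le_sum fun e _ => h e).trans ?_
  rw [Finset.sum_const, Finset.card_univ, Fintype.card_embedding_eq, Fintype.card_fin,
    Fintype.card_fin, nsmul_eq_mul]
  have : (m.descFactorial k : ℝ) ≤ (m : ℝ) ^ k := by
    exact_mod_cast Nat.descFactorial_le_pow m k
  calc _ ≤ (m : ℝ) ^ k * (2 * ((k.factorial : ℝ)⁻¹) ^ 2) := by gcongr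
    _ = _ := by
      field_simp

end

lemma exists_strictMono_enumeration {ι : Type*} {S : Finset ι} {k : ℕ} (hS : S.card = k)
    {f g : ι → ℝ} (h : ∀ i ∈ S, ∀ j ∈ S, i ≠ j → 0 < (f i - f j) * (g i - g j)) :
    ∃ e : Fin k ↪ ι, StrictMono (f ∘ e) ∧ StrictMono (g ∘ e) := by
  classical
  have hinj : Set.InjOn f S := by
    intro i hi j hj hij
    by_contra hne
    have := h i hi j hj hne
    simp [hij] at this
  have hcard : (S.image f).card = k := by rw [Finset.card_image_of_injOn hinj, hS]
  have hex : ∀ i, ∃ a ∈ S, f a = (S.image f).orderEmbOfFin hcard i := fun i =>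
    Finset.mem_image.mp (Finset.orderEmbOfFin_mem _ hcard i)
  choose e heS hef using hex
  have hmono : StrictMono (f ∘ e) := by
    intro i j hij
    simp only [Function.comp_apply, hef]
    simpa using hij
  have he : Function.Injective e := hmono.injective.of_comp
  refine ⟨⟨e, he⟩, hmono, fun i j hij => ?_⟩
  have h1 : f (e i) < f (e j) := hmono hij
  have h2 := h _ (heS i) _ (heS j) (he.ne hij.ne)
  have h3 := neg_of_mul_pos_right h2 (sub_neg.mpr h1).le
  exact sub_neg.mp h3

lemma chain_probability_bound {n m k : ℕ} (hk : 1 ≤ k) (hn : n ≤ 12 * k + 2)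
    (hm : (m : ℝ) ≤ ((n : ℝ) / (48 * Real.exp 1)) ^ 2) :
    2 * (m : ℝ) ^ k / (k.factorial : ℝ) ^ 2 ≤ 8 * (4 : ℝ) ^ (-(n : ℝ) / 12) := by
  have hfac : 0 < (k.factorial : ℝ) := by exact_mod_cast k.factorial_pos
  have hk0 : (0 : ℝ) < k := by exact_mod_cast hk
  have hk1 : (1 : ℝ) ≤ k := by exact_mod_cast hk
  have hn' : (n : ℝ) ≤ 12 * k + 2 := by exact_mod_cast hn
  -- One term of the exponential series: `k ^ k / k! ≤ e ^ k`.
  have hstir : (k / Real.exp 1 : ℝ) ^ k ≤ k.factorial := by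
    have := Real.pow_div_factorial_le_exp (x := k) hk0.le k
    rw [div_le_iff₀ hfac] at this
    rw [div_pow, div_le_iff₀ (by positivity), ← Real.exp_nat_mul, mul_one, mul_comm]
    exact this
  -- Since `k ≥ 1`, `n ≤ 12 * k + 2 ≤ 24 * k`; the 48 thus leaves the factor 1/2 that becomes `4 ^
  -- (-k)`.
  have hm' : (m : ℝ) ≤ ((k / Real.exp 1) / 2) ^ 2 := by
    refine hm.trans ?_
    refine pow_le_pow_left₀ (by positivity) ?_ 2
    rw [div_div, div_le_div_iff₀ (by positivity) (by positivity)]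
    have := Real.exp_pos 1
    nlinarith
  have h1 : (m : ℝ) ^ k ≤ (k.factorial : ℝ) ^ 2 * (1 / 4) ^ k := by
    calc (m : ℝ) ^ k ≤ (((k / Real.exp 1) / 2) ^ 2) ^ k := by gcongr
      _ = ((k / Real.exp 1) ^ k) ^ 2 * (1 / 4) ^ k := by
        rw [div_pow _ (2 : ℝ), div_eq_mul_inv, mul_pow, ← pow_mul, ← pow_mul, mul_comm 2 k]
        norm_num
      _ ≤ _ := by gcongr
  calc 2 * (m : ℝ) ^ k / (k.factorial : ℝ) ^ 2 ≤ 2 * (1 / 4) ^ k := by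
        rw [div_le_iff₀ (by positivity)]
        linarith
    _ = 8 * (4 : ℝ) ^ (-1 - (k : ℝ)) := by
        rw [Real.rpow_sub (by norm_num), Real.rpow_natCast, Real.rpow_neg_one, one_div, inv_pow]
        ring
    _ ≤ _ := by
        gcongr
        · norm_num
        · linarith

/-! ### Measurability of universality -/

lemma isClosed_exists_of_compactSpace {A B : Type*} [TopologicalSpace A] [TopologicalSpace B]
    [CompactSpace B] {p : A → B → Prop} (h : IsClosed {x : A × B | p x.1 x.2}) :
    IsClosed {a | ∃ b, p a b} := by
  convert isClosedMap_fst_of_compactSpace _ h using 1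
  ext a
  simp

lemma mem_segment_iff_exists_unitInterval {a b z : ℝ × ℝ} :
    z ∈ segment ℝ a b ↔ ∃ t : unitInterval, (1 - (t : ℝ)) • a + (t : ℝ) • b = z := by
  rw [segment_eq_image]
  constructor
  · rintro ⟨t, ht, rfl⟩
    exact ⟨⟨t, ht⟩, rfl⟩
  · rintro ⟨t, rfl⟩
    exact ⟨t, t.2, rfl⟩

/-- A forbidden incidence is the projection of a closed set along a compact parameter space, hence
closed. Crossing away from shared endpoints is not a closed condition, so it is exhausted by
crossings at distance at least `1 / (N + 1)` from them. -/
lemma measurableSet_isPlaneDrawing_segment {V : Type*} [Finite V] (G : SimpleGraph V) :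
    MeasurableSet {p : V → ℝ × ℝ | IsPlaneDrawing G p fun u v => segment ℝ (p u) (p v)} := by
  have hiff : ∀ p : V → ℝ × ℝ, (IsPlaneDrawing G p fun u v => segment ℝ (p u) (p v)) ↔
      (∀ u v, u ≠ v → p u ≠ p v) ∧
      (∀ u v w, G.Adj u v ∧ w ≠ u ∧ w ≠ v → ¬ ∃ t : unitInterval,
        (1 - (t : ℝ)) • p u + (t : ℝ) • p v = p w) ∧
      ∀ u v x y, G.Adj u v ∧ G.Adj x y ∧ s(u, v) ≠ s(x, y) →
        ∀ N : ℕ, ¬ ∃ t : unitInterval × unitInterval,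
          (1 - (t.1 : ℝ)) • p u + (t.1 : ℝ) • p v = (1 - (t.2 : ℝ)) • p x + (t.2 : ℝ) • p y ∧
          ∀ w ∈ (({u, v} : Set V) ∩ {x, y}),
            1 / ((N : ℝ) + 1) ≤ dist (p w) ((1 - (t.1 : ℝ)) • p u + (t.1 : ℝ) • p v) := by
    intro p
    constructor
    · intro h
      refine ⟨fun u v huv => h.pos_injective.ne huv, ?_, ?_⟩
      · rintro u v w ⟨huv, h1, h2⟩ ht
        rcases h.vertex_mem u v w huv (mem_segment_iff_exists_unitInterval.mpr ht) with e | e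
        · exact h1 e
        · exact h2 e
      · rintro u v x y ⟨huv, hxy, hne⟩ N ⟨⟨t, s⟩, heq, hd⟩
        obtain ⟨w, hw, he⟩ := h.inter_subset u v x y huv hxy hne
          ⟨mem_segment_iff_exists_unitInterval.mpr ⟨t, rfl⟩,
            mem_segment_iff_exists_unitInterval.mpr ⟨s, heq.symm⟩⟩
        have := hd w hw
        rw [he, dist_self] at this
        exact absurd this (not_le.mpr (by positivity))
    · rintro ⟨h1, h2, h3⟩
      have hinj : Function.Injective p := fun u v huv => by
        by_contra hne
        exact h1 u v hne huv
      refine ⟨hinj, fun u v _ => segment_symm _ _ _,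
        fun u v huv => exists_path_range_eq_segment (hinj.ne huv.ne), ?_, ?_⟩
      · intro u v w huv hw
        by_contra! hne
        exact h2 u v w ⟨huv, hne⟩ (mem_segment_iff_exists_unitInterval.mp hw)
      · rintro u v x y huv hxy hne z ⟨hz1, hz2⟩
        obtain ⟨t, ht⟩ := mem_segment_iff_exists_unitInterval.mp hz1
        obtain ⟨s, hs⟩ := mem_segment_iff_exists_unitInterval.mp hz2
        by_contra hz
        have hev : ∀ᶠ N : ℕ in Filter.atTop, ∀ w ∈ (({u, v} : Set V) ∩ {x, y}),
            1 / ((N : ℝ) + 1) ≤ dist (p w) z := by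
          rw [Filter.eventually_all_finite (Set.toFinite _)]
          intro w hw
          have hpos : 0 < dist (p w) z := dist_pos.mpr fun e => hz ⟨w, hw, e⟩
          exact (tendsto_one_div_add_atTop_nhds_zero_nat.eventually_lt_const hpos).mono
            fun N hN => hN.le
        obtain ⟨N, hN⟩ := hev.exists
        refine h3 u v x y ⟨huv, hxy, hne⟩ N ⟨⟨t, s⟩, ht.trans hs.symm, ?_⟩
        simpa only [ht] using hN
  simp only [hiff, Set.ofPred_and, Set.ofPred_forall]
  have : Countable V := Finite.to_countable
  refine MeasurableSet.inter ?_ (MeasurableSet.inter ?_ ?_)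
  · refine MeasurableSet.iInter fun u => MeasurableSet.iInter fun v => MeasurableSet.iInter fun _ =>
      IsOpen.measurableSet ?_
    exact isOpen_ne_fun (continuous_apply u) (continuous_apply v)
  · refine MeasurableSet.iInter fun u => MeasurableSet.iInter fun v => MeasurableSet.iInter fun w =>
      MeasurableSet.iInter fun _ => MeasurableSet.compl (IsClosed.measurableSet ?_)
    refine isClosed_exists_of_compactSpace
      (p := fun (p : V → ℝ × ℝ) (t : unitInterval) =>
        (1 - (t : ℝ)) • p u + (t : ℝ) • p v = p w) ?_
    exact isClosed_eq (by fun_prop) (by fun_prop)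
  · refine MeasurableSet.iInter fun u => MeasurableSet.iInter fun v => MeasurableSet.iInter fun x =>
      MeasurableSet.iInter fun y => MeasurableSet.iInter fun _ => MeasurableSet.iInter fun N =>
      MeasurableSet.compl (IsClosed.measurableSet ?_)
    refine isClosed_exists_of_compactSpace
      (p := fun (p : V → ℝ × ℝ) (t : unitInterval × unitInterval) =>
        (1 - (t.1 : ℝ)) • p u + (t.1 : ℝ) • p v = (1 - (t.2 : ℝ)) • p x + (t.2 : ℝ) • p y ∧
          ∀ w ∈ (({u, v} : Set V) ∩ {x, y}),
            1 / ((N : ℝ) + 1) ≤ dist (p w) ((1 - (t.1 : ℝ)) • p u + (t.1 : ℝ) • p v)) ?_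
    simp only [Set.ofPred_and, Set.ofPred_forall]
    refine (isClosed_eq (by fun_prop) (by fun_prop)).inter
      (isClosed_iInter fun w => isClosed_iInter fun _ => isClosed_le (by fun_prop) (by fun_prop))

lemma isUniversalPointSet_range_iff {n m : ℕ} {x : Fin m → ℝ × ℝ} :
    IsUniversalPointSet n (Set.range x) ↔ ∀ G : SimpleGraph (Fin n), IsPlanarGraph G →
      ∃ f : Fin n → Fin m, IsPlaneDrawing G (fun v => x (f v))
        fun u v => segment ℝ (x (f u)) (x (f v)) := by
  refine forall₂_congr fun G _ => ⟨?_, ?_⟩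
  · rintro ⟨pos, hpos, h⟩
    choose f hf using hpos
    obtain rfl : (fun v => x (f v)) = pos := funext hf
    exact ⟨f, h⟩
  · rintro ⟨f, h⟩
    exact ⟨fun v => x (f v), fun v => ⟨f v, rfl⟩, h⟩

lemma nullMeasurableSet_isUniversalPointSet {Ω : Type*} [MeasurableSpace Ω] {P : Measure Ω}
    {n m : ℕ} {X : Fin m → Ω → ℝ × ℝ} (hX : ∀ i, AEMeasurable (X i) P) :
    NullMeasurableSet {ω | IsUniversalPointSet n (Set.range fun i => X i ω)} P := by
  simp only [isUniversalPointSet_range_iff, Set.ofPred_forall, Set.ofPred_exists]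
  have : Countable (SimpleGraph (Fin n)) := Finite.to_countable
  refine NullMeasurableSet.iInter fun G => NullMeasurableSet.iInter fun _ =>
    NullMeasurableSet.iUnion fun f => ?_
  exact (aemeasurable_pi_lambda _ fun v => hX (f v)).nullMeasurableSet_preimage
    (measurableSet_isPlaneDrawing_segment G)

/-! ### Conclusion -/

lemma exists_monotone_of_isUniversalPointSet {n m k : ℕ} {x : Fin m → ℝ × ℝ}
    (hk : 12 * k ≤ n + 9) (h : IsUniversalPointSet n (Set.range x)) :
    ∃ e : Fin k ↪ Fin m, (StrictMono fun j => (x (e j)).1) ∧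
      ((StrictMono fun j => (x (e j)).2) ∨ StrictAnti fun j => (x (e j)).2) := by
  obtain ⟨f, hf⟩ := isUniversalPointSet_range_iff.mp h _ (isPlanarGraph_pathCube n)
  have hfinj : Function.Injective f := fun u v huv =>
    hf.pos_injective (congrArg x huv)
  obtain ⟨S, hS, hor⟩ := exists_monotone_chain_of_isPlaneDrawing hf
  obtain ⟨T, hTS, hT⟩ := Finset.exists_subset_card_eq (by omega : k ≤ S.card)
  rcases hor with hor | hor
  · obtain ⟨e, h1, h2⟩ := exists_strictMono_enumeration hT
      (f := fun i => (x (f i)).1) (g := fun i => (x (f i)).2)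
      fun i hi j hj hij => hor i (hTS hi) j (hTS hj) hij
    exact ⟨e.trans ⟨f, hfinj⟩, h1, Or.inl h2⟩
  -- Negating y turns a decreasing chain into an increasing one.
  · obtain ⟨e, h1, h2⟩ := exists_strictMono_enumeration hT
      (f := fun i => (x (f i)).1) (g := fun i => -(x (f i)).2)
      fun i hi j hj hij => by
        have := hor i (hTS hi) j (hTS hj) hij
        linarith
    exact ⟨e.trans ⟨f, hfinj⟩, h1, Or.inr fun i j hij => neg_lt_neg_iff.mp (h2 hij)⟩

theorem theorem1 (n m : ℕ) {Ω : Type*} [MeasurableSpace Ω]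
    (P : Measure Ω) [IsProbabilityMeasure P] (X : Fin m → Ω → ℝ × ℝ)
    (hindep : iIndepFun X P)
    (hunif : ∀ i, pdf.IsUniform (X i) unitSquare P volume)
    (hm : (m : ℝ) ≤ ((n : ℝ) / (48 * Real.exp 1)) ^ 2) :
    NullMeasurableSet {ω | ¬ IsUniversalPointSet n (Set.range fun i => X i ω)} P ∧
      1 - 8 * (4 : ℝ) ^ (-(n : ℝ) / 12) ≤
        P.real {ω | ¬ IsUniversalPointSet n (Set.range fun i => X i ω)} := by
  have hX : ∀ i, AEMeasurable (X i) P := fun i =>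
    (hunif i).aemeasurable (by simp [volume_unitSquare]) (by simp [volume_unitSquare])
  have hnull := nullMeasurableSet_isUniversalPointSet (n := n) hX
  refine ⟨hnull.compl, ?_⟩
  rcases Nat.lt_or_ge n 3 with hn | hn
  -- For `n < 3` the claimed lower bound is negative, as `8 * 4 ^ (-n / 12) ≥ 8 / 4`.
  · refine le_trans ?_ measureReal_nonneg
    have h1 : (4 : ℝ) ^ (-1 : ℝ) ≤ 4 ^ (-(n : ℝ) / 12) := by
      have : (n : ℝ) < 3 := by exact_mod_cast hn
      gcongr
      · norm_num
      · linarith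
    rw [Real.rpow_neg_one] at h1
    linarith
  -- The least `k` with `n ≤ 12 * k + 2`, the guaranteed chain length; `n ≥ 3` makes it positive.
  · let k := (n + 9) / 12
    have hbound : P.real {ω | IsUniversalPointSet n (Set.range fun i => X i ω)} ≤
        8 * (4 : ℝ) ^ (-(n : ℝ) / 12) :=
      (measureReal_mono fun ω hω =>
        exists_monotone_of_isUniversalPointSet (k := k) (by omega) hω).trans
      ((measureReal_exists_monotone_le hindep hunif k).trans
        (chain_probability_bound (by omega) (by omega) hm))
    have := probReal_compl_eq_one_sub₀ hnull
    rw [Set.compl_ofPred] at this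
    linarith
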